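/- Let $\alpha\in\mathbb R$ be Diophantine, i.e. there are $C,\gamma>0$ with $|k\alpha-l|\ge C|k|^{-\gamma}$ for all $k\in\mathbb Z\setminus\{0\}$ and $l\in\mathbb Z$, and consider the map $\Psi_\alpha(p,q)=(p+\alpha,q+2p)$ of the torus $T^2=\mathbb R^2/\mathbb Z^2$. For $N\ge 1$ let $H_N=L^2(\mathbb Z/N\mathbb Z)$ with $\langle\psi,\phi\rangle=\frac1N\sum_{q}\overline{\psi(q)}\phi(q)$, and write $e_N(x)=e^{2\pi i x/N}$. For $n=(n_1,n_2)\in\mathbb Z^2$ let $(T_N(n)\psi)(q)=e_N(n_1n_2/2)\,e_N(n_2q)\,\psi(q+n_1)$, and for $a\in C^\infty(T^2)$ (complex valued) let $\operatorname{Op}_N[a]=\sum_{n\in\mathbb Z^2}\hat a(n)T_N(n)$, where $\hat a(n)=\int_{T^2}a(p,q)e^{-2\pi i(n_1p+n_2q)}\,dp\,dq$; put $\bar a=\hat a(0)=\int_{T^2}a$. The Marklof–Rudnick quantization of $\Psi_\alpha$ is the following: choose integers $\nu_N$ ($N\ge1$) with $|\alpha-\nu_N/N|\le K/N$ for a constant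 $K$ independent of $N$, and let $U_N$ be the unitary operator on $H_N$ given by $$(U_N\psi)(q)=e_N(\nu_Nq)\,\frac1N\sum_{P\in\mathbb Z/N\mathbb Z}e_N(Pq-P^2)\sum_{q'\in\mathbb Z/N\mathbb Z}e_N(-Pq')\psi(q'),$$ which is, up to a phase factor, the only unitary operator such that $U_N^{-1}\operatorname{Op}_N[a]U_N=\operatorname{Op}_N[a\circ\Psi_{\nu_N/N}]$ for all $a\in C^\infty(T^2)$. Then for every $a\in C^\infty(T^2)$ there is a constant $C_a$ such that for every $N\ge 1$ and every orthonormal basis $\psi^N_1,\dots,\psi^N_N$ of $H_N$ consisting of eigenfunctions of $U_N$, $$\frac1N\sum_{j=1}^N\bigl|\langle\psi_j^N,\operatorname{Op}_N[a]\psi_j^N\rangle-\bar a\bigr|^2\le C_a\,\frac1{N^{1/2}}.$$ If moreover $a$ depends only on $p$, then for every $\varepsilon>0$ there is a constant $C_{a,\varepsilon}$ such that for every $N\ge1$ and every such basis $$\frac1N\sum_{j=1}^N\bigl|\langle\psi_j^N,\operatorname{Op}_N[a]\psi_j^N\rangle-\bar a\bigr|^2\le C_{a,\varepsilon}\,\frac1{N^{1-\varepsilon}}.$$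 (The constants may also depend on $\alpha$ and on the choice of the $\nu_N$.) -/

import Mathlib

noncomputable section

namespace ParabolicMap

/-- `α` is Diophantine: `|k α - l| ≥ C / |k|^γ` for some `C, γ > 0` and all integers `k ≠ 0`, `l`.
(`l = 0` is included; this only excludes `α = 0`.) -/
def Diophantine (α : ℝ) : Prop :=
  ∃ C γ : ℝ, 0 < C ∧ 0 < γ ∧ ∀ k l : ℤ, k ≠ 0 → C / |(k : ℝ)| ^ γ ≤ |(k : ℝ) * α - (l : ℝ)|

/-- `a ∈ C^∞(T²)`, `T² = ℝ²/ℤ²`, as a `ℤ²`-periodic smooth function of `(p, q) ∈ ℝ²`. -/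
structure IsTorusSymbol (a : ℝ × ℝ → ℂ) : Prop where
  smooth : ContDiff ℝ (⊤ : ℕ∞) a
  periodic_p : ∀ p q : ℝ, a (p + 1, q) = a (p, q)
  periodic_q : ∀ p q : ℝ, a (p, q + 1) = a (p, q)

/-- `a` depends on `p` only. -/
def DependsOnlyOnP (a : ℝ × ℝ → ℂ) : Prop :=
  ∀ p q q' : ℝ, a (p, q) = a (p, q')

/-- The mean `∫_{T²} a`. -/
def mean (a : ℝ × ℝ → ℂ) : ℂ :=
  ∫ p in (0 : ℝ)..1, ∫ q in (0 : ℝ)..1, a (p, q)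

/-- The Fourier coefficient `∫_{T²} a(p,q) exp(-2πi(n₁ p + n₂ q)) dp dq`. -/
def fourierCoeffTorus (a : ℝ × ℝ → ℂ) (n : ℤ × ℤ) : ℂ :=
  ∫ p in (0 : ℝ)..1, ∫ q in (0 : ℝ)..1,
    a (p, q) * Complex.exp (-(2 * Real.pi * Complex.I * ((n.1 : ℂ) * p + (n.2 : ℂ) * q)))

variable (N : ℕ) [NeZero N]

/-- The inner product `⟨ψ, φ⟩ = (1/N) ∑_q conj(ψ(q)) φ(q)` of `H_N = L²(ℤ/N)`. -/
def innerN (ψ φ : ZMod N → ℂ) : ℂ :=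
  (1 / (N : ℂ)) * ∑ q : ZMod N, starRingEnd ℂ (ψ q) * φ q

/-- The phase space translation `T_N(n)`,
`(T_N(n)ψ)(q) = e_N(n₁n₂/2) e_N(n₂ q) ψ(q + n₁)` with `e_N(x) = exp(2πi x/N)`
(on residue classes `e_N` is `ZMod.stdAddChar`). -/
def translation (n : ℤ × ℤ) (ψ : ZMod N → ℂ) : ZMod N → ℂ := fun q =>
  Complex.exp (2 * Real.pi * Complex.I * ((n.1 : ℂ) * (n.2 : ℂ) / 2) / (N : ℂ)) *
    ZMod.stdAddChar ((n.2 : ZMod N) * q) * ψ (q + (n.1 : ZMod N))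

/-- The Weyl quantisation `Op_N[a] = ∑_{n ∈ ℤ²} â(n) T_N(n)`. -/
def weylOp (a : ℝ × ℝ → ℂ) (ψ : ZMod N → ℂ) : ZMod N → ℂ := fun q =>
  ∑' n : ℤ × ℤ, fourierCoeffTorus a n * translation N n ψ q

/-- The quantisation of the map `(p, q) ↦ (p + ν/N, q + 2p)` of `T²`: multiplication by `e_N(-P²)`
in the momentum representation (the quantisation of the shear `(p, q) ↦ (p, q + 2p)`), followed by
multiplication by `e_N(ν q)` (the quantisation of the translation of `p` by `ν/N`). -/
def quantumParabolic (ν : ℤ) (ψ : ZMod N → ℂ) : ZMod N → ℂ := fun q =>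
  ZMod.stdAddChar ((ν : ZMod N) * q) *
    ZMod.dft.symm (fun P : ZMod N => ZMod.stdAddChar (-(P ^ 2)) * ZMod.dft ψ P) q

/-- `ψ_1, …, ψ_N` is an orthonormal basis of the `N`-dimensional space `H_N` consisting of
eigenfunctions of `U`. -/
structure IsOrthonormalEigenbasis (U : (ZMod N → ℂ) → (ZMod N → ℂ))
    (ψ : Fin N → ZMod N → ℂ) : Prop where
  orthonormal : ∀ i j : Fin N, innerN N (ψ i) (ψ j) = if i = j then 1 else 0
  eigen : ∀ j : Fin N, ∃ μ : ℂ, U (ψ j) = μ • ψ j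

/-- The quantum variance `(1/N) ∑_j |⟨ψ_j, Op_N[a] ψ_j⟩ - ā|²`. -/
def quantumVariance (a : ℝ × ℝ → ℂ) (ψ : Fin N → ZMod N → ℂ) : ℝ :=
  (1 / (N : ℝ)) * ∑ j : Fin N, ‖innerN N (ψ j) (weylOp N a (ψ j)) - mean a‖ ^ 2

end ParabolicMap

end

/-! The variance is in fact `O(1/N)` for every symbol, which gives both rates. By exact Egorov
(`translation_quantumParabolic`), conjugation by `U_N` sends `T_N(n)` to `T_N(n₁ + 2n₂, n₂)` up to a
phase, so an eigenfunction has equal matrix elements, up to phases, along the orbit `(n₁ + 2tn₂,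
n₂)`.

If `n₂ ≠ 0`, average over about `N/(2|n₂|)` orbit points with distinct displacements mod `N`. These
translations are Hilbert–Schmidt orthogonal, so `∑_j |⟨ψ_j, T_N(n)ψ_j⟩|² ≤ 4|n₂|`. If `n₂ = 0`, the
matrix element vanishes unless `N ∣ ν n₁`; then the Diophantine condition bounds `N` by a power of
`|n₁|`, and the trivial bound `N` suffices.

The bound is thus polynomial in `n`, uniformly in `N`. Minkowski's inequality in `ℓ²` over `j` and
rapid decay of Fourier coefficients sum it over `n`. -/

noncomputable section

namespace ParabolicMap

open Finset

/-! ### Unitarity, exact Egorov property, and matrix elements of translations. -/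

section Dynamics

variable (N : ℕ)

/-- The scalar `e_N(n₁ n₂ / 2)` of the phase space translation. -/
def weylPhase (n : ℤ × ℤ) : ℂ :=
  Complex.exp (2 * Real.pi * Complex.I * ((n.1 : ℂ) * (n.2 : ℂ) / 2) / (N : ℂ))

lemma norm_weylPhase (n : ℤ × ℤ) : ‖weylPhase N n‖ = 1 := by
  have : (2 * Real.pi * Complex.I * ((n.1 : ℂ) * (n.2 : ℂ) / 2) / (N : ℂ)) =
      ((2 * Real.pi * ((n.1 : ℝ) * (n.2 : ℝ) / 2) / (N : ℝ) : ℝ) : ℂ) * Complex.I := by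
    push_cast; ring
  rw [weylPhase, this, Complex.norm_exp_ofReal_mul_I]

variable [NeZero N]

lemma conj_stdAddChar (x : ZMod N) :
    starRingEnd ℂ (ZMod.stdAddChar x) = ZMod.stdAddChar (-x) :=
  (AddChar.map_neg_eq_conj _ _).symm

lemma norm_stdAddChar (x : ZMod N) : ‖(ZMod.stdAddChar x : ℂ)‖ = 1 :=
  AddChar.norm_apply _ _

/-- The inverse discrete Fourier transform is `1 / N` times the adjoint of the transform. -/
lemma sum_conj_mul_invDFT (f g : ZMod N → ℂ) :
    ∑ q, starRingEnd ℂ (f q) * ZMod.dft.symm g q =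
      (N : ℂ)⁻¹ * ∑ P, starRingEnd ℂ (ZMod.dft f P) * g P := by
  simp only [ZMod.invDFT_apply, ZMod.dft_apply, smul_eq_mul, map_sum, map_mul, conj_stdAddChar,
    neg_neg, Finset.mul_sum, Finset.sum_mul]
  rw [Finset.sum_comm]
  refine Finset.sum_congr rfl fun P _ => Finset.sum_congr rfl fun q _ => ?_
  rw [mul_comm q P]
  ring

lemma innerN_quantumParabolic (ν : ℤ) (φ ψ : ZMod N → ℂ) :
    innerN N (quantumParabolic N ν φ) (quantumParabolic N ν ψ) = innerN N φ ψ := by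
  have unit (x : ZMod N) (z w : ℂ) :
      starRingEnd ℂ (ZMod.stdAddChar x * z) * (ZMod.stdAddChar x * w) = starRingEnd ℂ z * w := by
    have : (ZMod.stdAddChar (-x) : ℂ) * ZMod.stdAddChar x = 1 := by
      rw [← AddChar.map_add_eq_mul]; simp
    rw [map_mul, conj_stdAddChar]
    linear_combination starRingEnd ℂ z * w * this
  unfold innerN quantumParabolic
  congr 1
  simp only [unit]
  rw [sum_conj_mul_invDFT]
  simp only [LinearEquiv.apply_symm_apply, unit]
  rw [← sum_conj_mul_invDFT, LinearEquiv.symm_apply_apply]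

lemma translation_apply (n : ℤ × ℤ) (ψ : ZMod N → ℂ) (q : ZMod N) :
    translation N n ψ q =
      weylPhase N n * ZMod.stdAddChar ((n.2 : ZMod N) * q) * ψ (q + (n.1 : ZMod N)) := rfl

/-- The half-integral phase is not a function of residues mod `N`, but its change under the shear
is. -/
lemma weylPhase_shear (n : ℤ × ℤ) :
    weylPhase N (n.1 + 2 * n.2, n.2) = weylPhase N n * ZMod.stdAddChar ((n.2 : ZMod N) ^ 2) := by
  have : ((n.2 : ZMod N) ^ 2) = ((n.2 ^ 2 : ℤ) : ZMod N) := by push_cast; rfl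
  rw [this, ZMod.stdAddChar_coe, weylPhase, weylPhase, ← Complex.exp_add]
  congr 1
  push_cast
  ring

lemma dft_translation (n : ℤ × ℤ) (ψ : ZMod N → ℂ) (P : ZMod N) :
    ZMod.dft (translation N n ψ) P =
      weylPhase N n * ZMod.stdAddChar ((n.1 : ZMod N) * (P - (n.2 : ZMod N))) * ZMod.dft ψ (P - (n.2 : ZMod N)) := by
  simp only [ZMod.dft_apply, smul_eq_mul, Finset.mul_sum, translation_apply]
  refine Fintype.sum_equiv (Equiv.addRight (n.1 : ZMod N)) _ _ fun q => ?_
  simp only [Equiv.coe_addRight]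
  have : (ZMod.stdAddChar (-(q * P)) : ℂ) * ZMod.stdAddChar ((n.2 : ZMod N) * q) =
      ZMod.stdAddChar ((n.1 : ZMod N) * (P - (n.2 : ZMod N))) *
        ZMod.stdAddChar (-((q + (n.1 : ZMod N)) * (P - (n.2 : ZMod N)))) := by
    rw [← AddChar.map_add_eq_mul, ← AddChar.map_add_eq_mul]
    congr 1; ring
  linear_combination weylPhase N n * ψ (q + (n.1 : ZMod N)) * this

/-- Exact Egorov property of the quantised parabolic map. -/
lemma translation_quantumParabolic (ν : ℤ) (n : ℤ × ℤ) (ψ : ZMod N → ℂ) :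
    translation N n (quantumParabolic N ν ψ) =
      (ZMod.stdAddChar ((ν : ZMod N) * (n.1 : ZMod N)) : ℂ) •
        quantumParabolic N ν (translation N (n.1 + 2 * n.2, n.2) ψ) := by
  have shear (q : ZMod N) :
      ZMod.dft.symm (fun P : ZMod N => ZMod.stdAddChar (-(P ^ 2)) *
        ZMod.dft (translation N (n.1 + 2 * n.2, n.2) ψ) P) q =
      weylPhase N n * ZMod.stdAddChar ((n.2 : ZMod N) * q) *
        ZMod.dft.symm (fun P : ZMod N => ZMod.stdAddChar (-(P ^ 2)) * ZMod.dft ψ P)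
          (q + (n.1 : ZMod N)) := by
    simp only [ZMod.invDFT_apply, smul_eq_mul, dft_translation, weylPhase_shear]
    rw [mul_left_comm]
    congr 1
    rw [Finset.mul_sum]
    refine Fintype.sum_equiv (Equiv.subRight (n.2 : ZMod N)) _ _ fun P => ?_
    simp only [Equiv.subRight_apply]
    push_cast
    -- Completing the square: the momentum shift by `n₂` in `-P²` produces the cross term `2 n₂ P`,
    -- which is the shear of `n₁`.
    have : (ZMod.stdAddChar (P * q) : ℂ) * ZMod.stdAddChar (-(P ^ 2)) *
        ZMod.stdAddChar ((n.2 : ZMod N) ^ 2) *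
        ZMod.stdAddChar (((n.1 : ZMod N) + 2 * (n.2 : ZMod N)) * (P - (n.2 : ZMod N))) =
        ZMod.stdAddChar ((n.2 : ZMod N) * q) * ZMod.stdAddChar ((P - (n.2 : ZMod N)) * (q + (n.1 : ZMod N))) *
          ZMod.stdAddChar (-((P - (n.2 : ZMod N)) ^ 2)) := by
      simp only [← AddChar.map_add_eq_mul]
      congr 1; ring
    linear_combination weylPhase N n * ZMod.dft ψ (P - (n.2 : ZMod N)) * this
  funext q
  rw [translation_apply, Pi.smul_apply, smul_eq_mul]
  simp only [quantumParabolic]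
  rw [shear]
  have : (ZMod.stdAddChar ((ν : ZMod N) * (q + (n.1 : ZMod N))) : ℂ) =
      ZMod.stdAddChar ((ν : ZMod N) * (n.1 : ZMod N)) * ZMod.stdAddChar ((ν : ZMod N) * q) := by
    rw [← AddChar.map_add_eq_mul]; congr 1; ring
  rw [this]
  ring

lemma innerN_smul_right (c : ℂ) (φ ψ : ZMod N → ℂ) :
    innerN N φ (c • ψ) = c * innerN N φ ψ := by
  simp only [innerN, Pi.smul_apply, smul_eq_mul, mul_left_comm _ c, ← Finset.mul_sum]

lemma innerN_smul_left (c : ℂ) (φ ψ : ZMod N → ℂ) :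
    innerN N (c • φ) ψ = starRingEnd ℂ c * innerN N φ ψ := by
  simp only [innerN, Pi.smul_apply, smul_eq_mul, map_mul, mul_assoc, ← Finset.mul_sum]
  ring

lemma translation_smul (n : ℤ × ℤ) (c : ℂ) (ψ : ZMod N → ℂ) :
    translation N n (c • ψ) = c • translation N n ψ := by
  funext q
  simp only [translation_apply, Pi.smul_apply, smul_eq_mul]
  ring

variable {N}

lemma innerN_translation_of_eigen {ν : ℤ} {ψ : ZMod N → ℂ} (h1 : innerN N ψ ψ = 1) {μ : ℂ}
    (hμ : quantumParabolic N ν ψ = μ • ψ) (n : ℤ × ℤ) :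
    innerN N ψ (translation N n ψ) = (ZMod.stdAddChar ((ν : ZMod N) * (n.1 : ZMod N)) : ℂ) *
      innerN N ψ (translation N (n.1 + 2 * n.2, n.2) ψ) := by
  -- Unitarity makes `μ` unimodular, so it cancels when `U` is applied in both slots.
  have hμ1 : starRingEnd ℂ μ * μ = 1 := by
    have := innerN_quantumParabolic N ν ψ ψ
    rwa [hμ, innerN_smul_left, innerN_smul_right, h1, mul_one] at this
  have key := congrArg (innerN N (quantumParabolic N ν ψ)) (translation_quantumParabolic N ν n ψ)
  rw [innerN_smul_right, innerN_quantumParabolic, hμ, translation_smul, innerN_smul_left,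
    innerN_smul_right, ← mul_assoc, hμ1, one_mul] at key
  exact key

lemma innerN_translation_eq_phase_mul {ν : ℤ} {ψ : ZMod N → ℂ} (h1 : innerN N ψ ψ = 1) {μ : ℂ}
    (hμ : quantumParabolic N ν ψ = μ • ψ) (n : ℤ × ℤ) (t : ℕ) :
    innerN N ψ (translation N n ψ) =
      (∏ s ∈ range t, (ZMod.stdAddChar ((ν : ZMod N) * ((n.1 + 2 * s * n.2 : ℤ) : ZMod N)) : ℂ)) *
        innerN N ψ (translation N (n.1 + 2 * t * n.2, n.2) ψ) := by
  induction t with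
  | zero => simp
  | succ t ih =>
    rw [ih, innerN_translation_of_eigen h1 hμ, prod_range_succ, ← mul_assoc]
    have : n.1 + 2 * (t : ℤ) * n.2 + 2 * n.2 = n.1 + 2 * ((t + 1 : ℕ) : ℤ) * n.2 := by
      push_cast
      ring
    simp only [this]

/-- Parseval's identity for a basis of `H_N` that is orthonormal for `innerN`. -/
lemma sum_norm_sq_of_orthonormal {ψ : Fin N → ZMod N → ℂ}
    (h : ∀ i j : Fin N, innerN N (ψ i) (ψ j) = if i = j then 1 else 0) (g : ZMod N → ℂ) :
    ∑ j, ‖∑ q, g q * ψ j q‖ ^ 2 = N * ∑ q, ‖g q‖ ^ 2 := by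
  have hN : (N : ℂ) ≠ 0 := NeZero.ne _
  let A : Matrix (Fin N) (ZMod N) ℂ := fun i q => (N : ℂ)⁻¹ * starRingEnd ℂ (ψ i q)
  let B : Matrix (ZMod N) (Fin N) ℂ := fun q j => ψ j q
  have hAB : A * B = 1 := by
    ext i j
    have := h i j
    rw [Matrix.mul_apply, Matrix.one_apply, ← this, innerN, Finset.mul_sum]
    simp [A, B, mul_assoc]
  -- Completeness follows from orthonormality: a one-sided inverse of a square matrix is two-sided.
  have hBA : B * A = 1 :=
    (Matrix.mul_eq_one_comm_of_card_eq _ _ _ (by simp [ZMod.card])).1 hAB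
  have complete (q q' : ZMod N) :
      ∑ j, ψ j q * starRingEnd ℂ (ψ j q') = if q = q' then (N : ℂ) else 0 := by
    have := congrFun (congrFun hBA q) q'
    rw [Matrix.mul_apply, Matrix.one_apply] at this
    have h2 : ∑ j, ψ j q * starRingEnd ℂ (ψ j q') = N * ∑ j, B q j * A j q' := by
      rw [Finset.mul_sum]
      refine Finset.sum_congr rfl fun j _ => ?_
      simp only [A, B]
      field_simp
    rw [h2, this]
    simp
  have sq (z : ℂ) : ((‖z‖ ^ 2 : ℝ) : ℂ) = z * starRingEnd ℂ z := by
    rw [Complex.mul_conj, Complex.normSq_eq_norm_sq]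
  apply Complex.ofReal_injective
  push_cast [-Complex.ofReal_pow]
  simp only [sq]
  calc ∑ j, (∑ q, g q * ψ j q) * starRingEnd ℂ (∑ q, g q * ψ j q)
      = ∑ j, ∑ q, ∑ q', g q * starRingEnd ℂ (g q') * (ψ j q * starRingEnd ℂ (ψ j q')) := by
        refine Finset.sum_congr rfl fun j _ => ?_
        rw [map_sum, Finset.sum_mul_sum]
        refine Finset.sum_congr rfl fun q _ => Finset.sum_congr rfl fun q' _ => ?_
        rw [map_mul]; ring
    _ = ∑ q, ∑ q', g q * starRingEnd ℂ (g q') * ∑ j, ψ j q * starRingEnd ℂ (ψ j q') := by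
        rw [Finset.sum_comm]
        refine Finset.sum_congr rfl fun q _ => ?_
        rw [Finset.sum_comm]
        simp only [Finset.mul_sum]
    _ = N * ∑ q, g q * starRingEnd ℂ (g q) := by
        simp only [complete, mul_ite, mul_zero, Finset.sum_ite_eq, Finset.mem_univ, if_true,
          Finset.mul_sum]
        exact Finset.sum_congr rfl fun q _ => mul_comm _ _

lemma norm_innerN_sq_le {φ : ZMod N → ℂ} (h1 : innerN N φ φ = 1) (χ : ZMod N → ℂ) :
    ‖innerN N φ χ‖ ^ 2 ≤ (N : ℝ)⁻¹ * ∑ q, ‖χ q‖ ^ 2 := by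
  have hN : (0 : ℝ) < N := by exact_mod_cast NeZero.pos N
  have hφ : ∑ q, ‖φ q‖ ^ 2 = (N : ℝ) := by
    apply Complex.ofReal_injective
    have hN' : (N : ℂ) ≠ 0 := NeZero.ne _
    rw [innerN, one_div, inv_mul_eq_one₀ hN'] at h1
    push_cast
    rw [h1]
    exact Finset.sum_congr rfl fun q _ => (Complex.conj_mul' _).symm
  rw [innerN, norm_mul, mul_pow]
  have h2 : ‖∑ q, starRingEnd ℂ (φ q) * χ q‖ ≤ ∑ q, ‖φ q‖ * ‖χ q‖ :=
    (norm_sum_le _ _).trans_eq (by simp)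
  have h3 : ‖∑ q, starRingEnd ℂ (φ q) * χ q‖ ^ 2 ≤ N * ∑ q, ‖χ q‖ ^ 2 := by
    rw [← hφ]
    exact (pow_le_pow_left₀ (norm_nonneg _) h2 2).trans (sum_mul_sq_le_sq_mul_sq _ _ _)
  have h4 : ‖(1 / (N : ℂ))‖ ^ 2 = (N : ℝ)⁻¹ ^ 2 := by simp
  rw [h4]
  calc (N : ℝ)⁻¹ ^ 2 * ‖∑ q, starRingEnd ℂ (φ q) * χ q‖ ^ 2
      ≤ (N : ℝ)⁻¹ ^ 2 * (N * ∑ q, ‖χ q‖ ^ 2) := by gcongr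
    _ = _ := by field_simp

/-- A combination of `T` translations by pairwise distinct amounts, with unimodular coefficients,
has squared Hilbert–Schmidt norm `N T`. -/
lemma sum_norm_innerN_sum_shift_sq_le {ψ : Fin N → ZMod N → ℂ}
    (h : ∀ i j : Fin N, innerN N (ψ i) (ψ j) = if i = j then 1 else 0) (T : ℕ)
    (m : ℕ → ZMod N) (hm : Set.InjOn m (range T)) (c : ℕ → ZMod N → ℂ) (hc : ∀ t q, ‖c t q‖ = 1) :
    ∑ j, ‖innerN N (ψ j) (fun q => ∑ t ∈ range T, c t q * ψ j (q + m t))‖ ^ 2 ≤ N * T := by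
  have hN : (N : ℝ) ≠ 0 := NeZero.ne _
  -- At fixed `q` the sum pairs `ψ j` with a vector `g` having `T` unimodular entries at distinct
  -- sites, so Parseval applies.
  have point (q : ZMod N) :
      ∑ j, ‖∑ t ∈ range T, c t q * ψ j (q + m t)‖ ^ 2 = N * T := by
    have hinj : Set.InjOn (fun t => q + m t) (range T) := fun s hs t ht hst =>
      hm hs ht (add_left_cancel hst)
    let g : ZMod N → ℂ := fun x => ∑ t ∈ range T, if q + m t = x then c t q else 0
    have hg (j : Fin N) : ∑ t ∈ range T, c t q * ψ j (q + m t) = ∑ x, g x * ψ j x := by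
      simp only [g, Finset.sum_mul, ite_mul, zero_mul]
      rw [Finset.sum_comm]
      simp
    have hg1 (t : ℕ) (ht : t ∈ range T) : g (q + m t) = c t q := by
      simp only [g]
      rw [Finset.sum_eq_single t]
      · simp
      · intro s hs hst
        rw [if_neg]
        exact fun he => hst (hinj hs ht he)
      · exact fun hn => absurd ht hn
    have hg0 (x : ZMod N) (hx : x ∉ (range T).image fun t => q + m t) : g x = 0 := by
      refine Finset.sum_eq_zero fun t ht => if_neg fun he => hx ?_
      exact Finset.mem_image.2 ⟨t, ht, he⟩
    simp only [hg]
    rw [sum_norm_sq_of_orthonormal h g]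
    congr 1
    rw [← Finset.sum_subset (Finset.subset_univ ((range T).image fun t => q + m t))
      (fun x _ hx => by simp [hg0 x hx]), Finset.sum_image hinj]
    rw [Finset.sum_congr rfl fun t ht => by rw [hg1 t ht, hc]]
    simp
  calc _ ≤ ∑ j, (N : ℝ)⁻¹ * ∑ q, ‖∑ t ∈ range T, c t q * ψ j (q + m t)‖ ^ 2 :=
        Finset.sum_le_sum fun j _ => norm_innerN_sq_le (by simp [h]) _
    _ = N * T := by
        rw [← Finset.mul_sum, Finset.sum_comm]
        simp only [point]
        simp [ZMod.card]
        field_simp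

lemma sum_norm_innerN_translation_sq_le {ψ : Fin N → ZMod N → ℂ}
    (h : ∀ i j : Fin N, innerN N (ψ i) (ψ j) = if i = j then 1 else 0) (n : ℤ × ℤ) :
    ∑ j, ‖innerN N (ψ j) (translation N n (ψ j))‖ ^ 2 ≤ N := by
  have := sum_norm_innerN_sum_shift_sq_le h 1 (fun _ => (n.1 : ZMod N)) (by simp)
    (fun _ q => weylPhase N n * ZMod.stdAddChar ((n.2 : ZMod N) * q))
    (fun _ q => by rw [norm_mul, norm_weylPhase, norm_stdAddChar, one_mul])
  simpa [funext (translation_apply N n _)] using this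

lemma innerN_sum {ι : Type*} (s : Finset ι) (φ : ZMod N → ℂ) (c : ι → ℂ) (f : ι → ZMod N → ℂ) :
    innerN N φ (fun q => ∑ t ∈ s, c t * f t q) = ∑ t ∈ s, c t * innerN N φ (f t) := by
  simp only [innerN, Finset.mul_sum]
  rw [Finset.sum_comm]
  refine Finset.sum_congr rfl fun t _ => Finset.sum_congr rfl fun q _ => by ring

/-- Averaging over the orbit of a translation under the shear. -/
lemma sum_norm_innerN_translation_sq_mul_le {ν : ℤ} {ψ : Fin N → ZMod N → ℂ}
    (h : IsOrthonormalEigenbasis N (quantumParabolic N ν) ψ) (n : ℤ × ℤ) (T : ℕ) (hT : 0 < T)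
    (hm : Set.InjOn (fun t : ℕ => ((n.1 + 2 * t * n.2 : ℤ) : ZMod N)) (range T)) :
    (∑ j, ‖innerN N (ψ j) (translation N n (ψ j))‖ ^ 2) * T ≤ N := by
  let z : ℕ → ℂ := fun t =>
    ∏ s ∈ range t, (ZMod.stdAddChar ((ν : ZMod N) * ((n.1 + 2 * s * n.2 : ℤ) : ZMod N)) : ℂ)
  have hz (t : ℕ) : ‖z t‖ = 1 := by
    simp only [z, norm_prod, norm_stdAddChar, Finset.prod_const_one]
  have main := sum_norm_innerN_sum_shift_sq_le h.orthonormal T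
    (fun t : ℕ => ((n.1 + 2 * t * n.2 : ℤ) : ZMod N)) hm
    (fun t q => z t * (weylPhase N (n.1 + 2 * t * n.2, n.2) *
      ZMod.stdAddChar ((n.2 : ZMod N) * q)))
    (fun t q => by simp only [norm_mul, hz, norm_weylPhase, norm_stdAddChar, one_mul])
  have hj (j : Fin N) : innerN N (ψ j) (fun q => ∑ t ∈ range T,
      z t * (weylPhase N (n.1 + 2 * t * n.2, n.2) * ZMod.stdAddChar ((n.2 : ZMod N) * q)) *
        ψ j (q + ((n.1 + 2 * t * n.2 : ℤ) : ZMod N))) =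
      T * innerN N (ψ j) (translation N n (ψ j)) := by
    obtain ⟨μ, hμ⟩ := h.eigen j
    have h1 : innerN N (ψ j) (ψ j) = 1 := by simp [h.orthonormal]
    have := innerN_sum (range T) (ψ j) z
      (fun t => translation N (n.1 + 2 * t * n.2, n.2) (ψ j))
    simp only [translation_apply, ← mul_assoc] at this ⊢
    rw [this, Finset.sum_congr rfl fun t _ =>
      (innerN_translation_eq_phase_mul h1 hμ n t).symm]
    simp
  simp only [hj, norm_mul, mul_pow, Complex.norm_natCast, ← Finset.mul_sum] at main
  have hT' : (0 : ℝ) < T := by exact_mod_cast hT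
  -- Averaging yields `T² ∑ ≤ N T`; one factor `T` cancels.
  refine le_of_mul_le_mul_right ?_ hT'
  linarith

/-- The averaging length is `T = ⌊N / (2|n₂|)⌋`: differences `2|n₂||t - s|` stay below `N`, so no
displacement repeats. When `N < 2|n₂|` the trivial bound `N` is enough. -/
lemma sum_norm_innerN_translation_sq_le_of_ne {ν : ℤ} {ψ : Fin N → ZMod N → ℂ}
    (h : IsOrthonormalEigenbasis N (quantumParabolic N ν) ψ) (n : ℤ × ℤ) (hn : n.2 ≠ 0) :
    ∑ j, ‖innerN N (ψ j) (translation N n (ψ j))‖ ^ 2 ≤ 4 * |(n.2 : ℝ)| := by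
  have hcast : |(n.2 : ℝ)| = (n.2.natAbs : ℝ) := by simp
  rw [hcast]
  have hpos : 0 < n.2.natAbs := Int.natAbs_pos.2 hn
  set k := 2 * n.2.natAbs with hk
  have hkpos : 0 < k := by omega
  rcases lt_or_ge N k with hlt | hge
  · refine (sum_norm_innerN_translation_sq_le h.orthonormal n).trans ?_
    have : N ≤ 4 * n.2.natAbs := by omega
    exact_mod_cast this
  set T := N / k with hTdef
  have hTpos : 0 < T := Nat.div_pos hge hkpos
  have hTN : k * T ≤ N := Nat.mul_div_le N k
  have hinj : Set.InjOn (fun t : ℕ => ((n.1 + 2 * t * n.2 : ℤ) : ZMod N)) (range T) := by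
    intro s hs t ht hst
    simp only [coe_range, Set.mem_Iio] at hs ht
    rw [ZMod.intCast_eq_intCast_iff_dvd_sub] at hst
    have he : (n.1 + 2 * (t : ℤ) * n.2) - (n.1 + 2 * (s : ℤ) * n.2) =
        2 * n.2 * ((t : ℤ) - s) := by ring
    rw [he, ← Int.natAbs_dvd_natAbs] at hst
    simp only [Int.natAbs_natCast, Int.natAbs_mul] at hst
    by_contra hne
    have hd : 0 < ((t : ℤ) - s).natAbs := by omega
    have hd' : ((t : ℤ) - s).natAbs < T := by omega
    have hle := Nat.le_of_dvd (by positivity) hst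
    have : k * ((t : ℤ) - s).natAbs < k * T := Nat.mul_lt_mul_of_pos_left hd' hkpos
    have h2 : (2 : ℤ).natAbs = 2 := rfl
    rw [h2, ← hk] at hle
    omega
  have main := sum_norm_innerN_translation_sq_mul_le h n T hTpos hinj
  have hT' : (0 : ℝ) < T := by exact_mod_cast hTpos
  refine le_of_mul_le_mul_right (main.trans ?_) hT'
  -- Rounding down loses at most a factor 2, since `T ≥ 1` gives `N < k (T + 1) ≤ 2 k T`.
  have : N ≤ 4 * n.2.natAbs * T := by
    have h1 : N < k * (T + 1) := Nat.lt_mul_div_succ N hkpos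
    have h2 : k * 1 ≤ k * T := Nat.mul_le_mul_left k hTpos
    have h3 : 4 * n.2.natAbs * T = k * T + k * T := by rw [hk]; ring
    rw [h3]
    linarith [mul_add k T 1]
  exact_mod_cast this

/-- The horizontal translations have vanishing matrix elements unless `N` divides `ν n₁`. -/
lemma innerN_translation_horizontal_eq_zero {ν : ℤ} {ψ : ZMod N → ℂ} (h1 : innerN N ψ ψ = 1)
    {μ : ℂ} (hμ : quantumParabolic N ν ψ = μ • ψ) (k : ℤ) (hk : ¬ (N : ℤ) ∣ ν * k) :
    innerN N ψ (translation N (k, 0) ψ) = 0 := by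
  -- The shear fixes `(k, 0)`, so the matrix element equals itself times `e_N(ν k)`.
  have key := innerN_translation_of_eigen h1 hμ (k, 0)
  simp only [mul_zero, add_zero] at key
  have hne : (ZMod.stdAddChar ((ν : ZMod N) * (k : ZMod N)) : ℂ) ≠ 1 := by
    intro he
    apply hk
    rw [← AddChar.map_zero_eq_one (ZMod.stdAddChar : AddChar (ZMod N) ℂ)] at he
    have := ZMod.injective_stdAddChar he
    rw [← ZMod.intCast_zmod_eq_zero_iff_dvd]
    exact_mod_cast this
  have : (1 - (ZMod.stdAddChar ((ν : ZMod N) * (k : ZMod N)) : ℂ)) *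
      innerN N ψ (translation N (k, 0) ψ) = 0 := by linear_combination key
  exact (mul_eq_zero.1 this).resolve_left (sub_ne_zero.2 hne.symm)

/-- Diophantine lower bound for the resonant horizontal frequencies. -/
lemma mul_le_of_dvd_of_diophantine {α C γ K : ℝ}
    (hC : ∀ k l : ℤ, k ≠ 0 → C / |(k : ℝ)| ^ γ ≤ |(k : ℝ) * α - (l : ℝ)|) {ν : ℤ}
    (hν : |α - (ν : ℝ) / (N : ℝ)| ≤ K / (N : ℝ)) {k : ℤ} (hk : k ≠ 0) (hdvd : (N : ℤ) ∣ ν * k) :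
    C * N ≤ K * |(k : ℝ)| ^ (1 + γ) := by
  obtain ⟨l, hl⟩ := hdvd
  have hN : (0 : ℝ) < N := by exact_mod_cast NeZero.pos N
  have hk0 : 0 < |(k : ℝ)| := abs_pos.2 (by exact_mod_cast hk)
  have hlr : (ν : ℝ) * k = N * l := by exact_mod_cast hl
  -- Resonance makes `ν k / N` the integer `l`, so `kα - l` has size at most `K|k|/N`.
  have he : (k : ℝ) * α - l = k * (α - (ν : ℝ) / N) := by
    field_simp
    linear_combination hlr
  have h1 := hC k l hk
  rw [he, abs_mul] at h1
  have h2 : C / |(k : ℝ)| ^ γ ≤ |(k : ℝ)| * (K / N) :=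
    h1.trans (mul_le_mul_of_nonneg_left hν hk0.le)
  rw [div_le_iff₀ (Real.rpow_pos_of_pos hk0 _)] at h2
  rw [Real.rpow_add hk0, Real.rpow_one]
  have h3 := mul_le_mul_of_nonneg_right h2 hN.le
  refine h3.trans_eq ?_
  field_simp

end Dynamics

end ParabolicMap

end

noncomputable section

namespace ParabolicMap

/-! ### Rapid decay of the Fourier coefficients of a smooth symbol. -/

section FourierDecay

open MeasureTheory

lemma norm_exp_neg_two_pi_I_mul (x : ℝ) :
    ‖Complex.exp (-(2 * Real.pi * Complex.I * (x : ℂ)))‖ = 1 := by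
  have : -(2 * Real.pi * Complex.I * (x : ℂ)) = ((-(2 * Real.pi * x) : ℝ) : ℂ) * Complex.I := by
    push_cast; ring
  rw [this, Complex.norm_exp_ofReal_mul_I]

/-- Integration by parts against a character over a period. -/
lemma integral_deriv_mul_exp {f f' : ℝ → ℂ} (hf : ∀ x, HasDerivAt f (f' x) x)
    (hf' : Continuous f') (hper : f 1 = f 0) (k : ℤ) (c : ℂ) :
    ∫ x in (0 : ℝ)..1, f' x * Complex.exp (-(2 * Real.pi * Complex.I * (c + (k : ℂ) * x))) =
      2 * Real.pi * Complex.I * k *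
        ∫ x in (0 : ℝ)..1, f x * Complex.exp (-(2 * Real.pi * Complex.I * (c + (k : ℂ) * x))) := by
  let e : ℝ → ℂ := fun x => Complex.exp (-(2 * Real.pi * Complex.I * (c + (k : ℂ) * x)))
  have he (x : ℝ) : HasDerivAt e (e x * (-(2 * Real.pi * Complex.I * k))) x := by
    have h1 : HasDerivAt (fun x : ℝ => -(2 * Real.pi * Complex.I * (c + (k : ℂ) * (x : ℂ))))
        (-(2 * Real.pi * Complex.I * k)) x := by
      have := ((((hasDerivAt_id x).ofReal_comp).const_mul (k : ℂ)).const_add c).const_mul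
        (2 * Real.pi * Complex.I)
      simpa [Pi.neg_def] using this.neg
    exact h1.cexp
  have hec : Continuous e := continuous_iff_continuousAt.2 fun x => (he x).continuousAt
  have he1 : e 1 = e 0 := by
    have : -(2 * Real.pi * Complex.I * (c + (k : ℂ) * ((1 : ℝ) : ℂ))) =
        -(2 * Real.pi * Complex.I * (c + (k : ℂ) * ((0 : ℝ) : ℂ))) +
          ((-k : ℤ) : ℂ) * (2 * Real.pi * Complex.I) := by
      push_cast; ring
    simp only [e]
    rw [this, Complex.exp_add, Complex.exp_int_mul_two_pi_mul_I, mul_one]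
  have parts := intervalIntegral.integral_mul_deriv_eq_deriv_mul (a := 0) (b := 1)
    (u := e) (v := f) (u' := fun x => e x * (-(2 * Real.pi * Complex.I * k))) (v' := f')
    (fun x _ => he x) (fun x _ => hf x)
    ((hec.mul continuous_const).intervalIntegrable _ _) (hf'.intervalIntegrable _ _)
  rw [he1, hper, sub_self, zero_sub, ← intervalIntegral.integral_neg] at parts
  rw [← intervalIntegral.integral_const_mul]
  calc _ = ∫ x in (0 : ℝ)..1, e x * f' x := by simp only [e, mul_comm]
    _ = _ := parts
    _ = _ := by
      refine intervalIntegral.integral_congr fun x _ => ?_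
      simp only [e]
      ring

variable {a : ℝ × ℝ → ℂ}

lemma IsTorusSymbol.fderiv_apply (h : IsTorusSymbol a) (v : ℝ × ℝ) :
    IsTorusSymbol fun x => fderiv ℝ a x v where
  smooth := (h.smooth.fderiv_right (m := ((⊤ : ℕ∞) : WithTop ℕ∞)) (by simp)).clm_apply
    contDiff_const
  periodic_p p q := by
    have hp : (fun x => a (x + (1, 0))) = a := by
      funext x
      obtain ⟨p, q⟩ := x
      simpa using h.periodic_p p q
    have := fderiv_comp_add_right (𝕜 := ℝ) (f := a) (x := (p, q)) (1, 0)
    rw [hp] at this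
    simp [this]
  periodic_q p q := by
    have hp : (fun x => a (x + (0, 1))) = a := by
      funext x
      obtain ⟨p, q⟩ := x
      simpa using h.periodic_q p q
    have := fderiv_comp_add_right (𝕜 := ℝ) (f := a) (x := (p, q)) (0, 1)
    rw [hp] at this
    simp [this]

lemma IsTorusSymbol.continuous (h : IsTorusSymbol a) : Continuous a := h.smooth.continuous

lemma IsTorusSymbol.hasFDerivAt (h : IsTorusSymbol a) (x : ℝ × ℝ) :
    HasFDerivAt a (fderiv ℝ a x) x :=
  (h.smooth.differentiable (by simp)).differentiableAt.hasFDerivAt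

lemma IsTorusSymbol.fourierCoeffTorus_fderiv_q (h : IsTorusSymbol a) (n : ℤ × ℤ) :
    fourierCoeffTorus (fun x => fderiv ℝ a x (0, 1)) n =
      2 * Real.pi * Complex.I * n.2 * fourierCoeffTorus a n := by
  unfold fourierCoeffTorus
  rw [← intervalIntegral.integral_const_mul]
  refine intervalIntegral.integral_congr fun p _ => ?_
  refine integral_deriv_mul_exp (f := fun q => a (p, q)) (fun q => ?_)
    ((h.fderiv_apply _).continuous.comp (by fun_prop)) ?_ _ _
  · exact (h.hasFDerivAt (p, q)).comp_hasDerivAt q ((hasDerivAt_const q p).prodMk (hasDerivAt_id q))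
  · simpa using h.periodic_q p 0

/-- Fubini puts the `p` integral inside, so one-variable integration by parts also handles `∂_p`. -/
lemma fourierCoeffTorus_swap (ha : Continuous a) (n : ℤ × ℤ) :
    fourierCoeffTorus a n = ∫ q in (0 : ℝ)..1, ∫ p in (0 : ℝ)..1,
      a (p, q) * Complex.exp (-(2 * Real.pi * Complex.I * ((n.2 : ℂ) * q + (n.1 : ℂ) * p))) := by
  unfold fourierCoeffTorus
  rw [intervalIntegral_intervalIntegral_swap]
  · simp only [add_comm]
  · have hc : Continuous (Function.uncurry fun p q : ℝ => a (p, q) *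
        Complex.exp (-(2 * Real.pi * Complex.I * ((n.1 : ℂ) * p + (n.2 : ℂ) * q)))) := by
      unfold Function.uncurry
      fun_prop
    exact (hc.continuousOn.integrableOn_compact
      (isCompact_uIcc.prod isCompact_uIcc)).mono_set
        (Set.prod_mono Set.uIoc_subset_uIcc Set.uIoc_subset_uIcc)

lemma IsTorusSymbol.fourierCoeffTorus_fderiv_p (h : IsTorusSymbol a) (n : ℤ × ℤ) :
    fourierCoeffTorus (fun x => fderiv ℝ a x (1, 0)) n =
      2 * Real.pi * Complex.I * n.1 * fourierCoeffTorus a n := by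
  rw [fourierCoeffTorus_swap (h.fderiv_apply _).continuous, fourierCoeffTorus_swap h.continuous,
    ← intervalIntegral.integral_const_mul]
  refine intervalIntegral.integral_congr fun q _ => ?_
  refine integral_deriv_mul_exp (f := fun p => a (p, q)) (fun p => ?_)
    ((h.fderiv_apply _).continuous.comp (by fun_prop)) ?_ _ _
  · exact (h.hasFDerivAt (p, q)).comp_hasDerivAt p ((hasDerivAt_id p).prodMk (hasDerivAt_const p q))
  · simpa using h.periodic_p 0 q

lemma exists_norm_fourierCoeffTorus_le (ha : Continuous a) :
    ∃ M : ℝ, ∀ n, ‖fourierCoeffTorus a n‖ ≤ M := by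
  obtain ⟨M, hM⟩ := ((isCompact_uIcc (a := (0 : ℝ)) (b := 1)).prod
    (isCompact_uIcc (a := (0 : ℝ)) (b := 1))).exists_bound_of_continuousOn ha.continuousOn
  refine ⟨M, fun n => ?_⟩
  unfold fourierCoeffTorus
  have := intervalIntegral.norm_integral_le_of_norm_le_const (a := (0 : ℝ)) (b := 1) (C := M)
    (f := fun p : ℝ => ∫ q in (0 : ℝ)..1, a (p, q) *
      Complex.exp (-(2 * Real.pi * Complex.I * ((n.1 : ℂ) * p + (n.2 : ℂ) * q)))) fun p hp => ?_
  · simpa using this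
  have := intervalIntegral.norm_integral_le_of_norm_le_const (a := (0 : ℝ)) (b := 1) (C := M)
    (f := fun q : ℝ => a (p, q) *
      Complex.exp (-(2 * Real.pi * Complex.I * ((n.1 : ℂ) * p + (n.2 : ℂ) * q)))) fun q hq => ?_
  · simpa using this
  have he := norm_exp_neg_two_pi_I_mul (n.1 * p + n.2 * q)
  push_cast at he
  rw [norm_mul, he, mul_one]
  exact hM (p, q) ⟨Set.uIoc_subset_uIcc hp, Set.uIoc_subset_uIcc hq⟩

lemma IsTorusSymbol.exists_fourierCoeffTorus_eq_pow_mul (h : IsTorusSymbol a) (i j : ℕ) :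
    ∃ b, IsTorusSymbol b ∧ ∀ n, fourierCoeffTorus b n =
      (2 * Real.pi * Complex.I * n.1) ^ i * (2 * Real.pi * Complex.I * n.2) ^ j *
        fourierCoeffTorus a n := by
  induction i with
  | zero =>
    induction j with
    | zero => exact ⟨a, h, by simp⟩
    | succ j ih =>
      obtain ⟨b, hb, hbn⟩ := ih
      refine ⟨_, hb.fderiv_apply (0, 1), fun n => ?_⟩
      rw [hb.fourierCoeffTorus_fderiv_q, hbn]
      ring
  | succ i ih =>
    obtain ⟨b, hb, hbn⟩ := ih
    refine ⟨_, hb.fderiv_apply (1, 0), fun n => ?_⟩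
    rw [hb.fourierCoeffTorus_fderiv_p, hbn]
    ring

lemma IsTorusSymbol.exists_pow_mul_norm_fourierCoeffTorus_le (h : IsTorusSymbol a) (i j : ℕ) :
    ∃ M : ℝ, ∀ n : ℤ × ℤ,
      |(n.1 : ℝ)| ^ i * |(n.2 : ℝ)| ^ j * ‖fourierCoeffTorus a n‖ ≤ M := by
  obtain ⟨b, hb, hbn⟩ := h.exists_fourierCoeffTorus_eq_pow_mul i j
  obtain ⟨M, hM⟩ := exists_norm_fourierCoeffTorus_le hb.continuous
  refine ⟨M, fun n => le_trans ?_ (hM n)⟩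
  rw [hbn, norm_mul, norm_mul, norm_pow, norm_pow]
  have hk (k : ℤ) : |(k : ℝ)| ≤ ‖(2 * Real.pi * Complex.I * k : ℂ)‖ := by
    have : ‖(2 * Real.pi * Complex.I * k : ℂ)‖ = 2 * Real.pi * |(k : ℝ)| := by
      simp [abs_of_pos Real.pi_pos]
    rw [this]
    have := Real.pi_gt_three
    nlinarith [abs_nonneg (k : ℝ)]
  gcongr
  · exact hk _
  · exact hk _

/-- The weight `(1 + |n₁|)(1 + |n₂|)` on the frequency lattice. -/
def latticeWeight (n : ℤ × ℤ) : ℝ := (1 + |(n.1 : ℝ)|) * (1 + |(n.2 : ℝ)|)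

lemma one_le_latticeWeight (n : ℤ × ℤ) : 1 ≤ latticeWeight n := by
  unfold latticeWeight
  nlinarith [abs_nonneg (n.1 : ℝ), abs_nonneg (n.2 : ℝ),
    mul_nonneg (abs_nonneg (n.1 : ℝ)) (abs_nonneg (n.2 : ℝ))]

/-- The Fourier coefficients of a smooth function on the torus decay rapidly. -/
lemma IsTorusSymbol.exists_latticeWeight_pow_mul_le (h : IsTorusSymbol a) (k : ℕ) :
    ∃ M : ℝ, ∀ n : ℤ × ℤ, latticeWeight n ^ k * ‖fourierCoeffTorus a n‖ ≤ M := by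
  obtain ⟨M₀, h₀⟩ := h.exists_pow_mul_norm_fourierCoeffTorus_le 0 0
  obtain ⟨M₁, h₁⟩ := h.exists_pow_mul_norm_fourierCoeffTorus_le k 0
  obtain ⟨M₂, h₂⟩ := h.exists_pow_mul_norm_fourierCoeffTorus_le 0 k
  obtain ⟨M₃, h₃⟩ := h.exists_pow_mul_norm_fourierCoeffTorus_le k k
  refine ⟨2 ^ k * 2 ^ k * (M₀ + M₁ + M₂ + M₃), fun n => ?_⟩
  have hpow (x : ℝ) (hx : 0 ≤ x) : (1 + x) ^ k ≤ 2 ^ k * (1 + x ^ k) := by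
    rcases le_total x 1 with hx1 | hx1
    · calc (1 + x) ^ k ≤ 2 ^ k := pow_le_pow_left₀ (by linarith) (by linarith) _
        _ ≤ 2 ^ k * (1 + x ^ k) := le_mul_of_one_le_right (by positivity) (by
          linarith [pow_nonneg hx k])
    · calc (1 + x) ^ k ≤ (2 * x) ^ k := pow_le_pow_left₀ (by linarith) (by linarith) _
        _ = 2 ^ k * x ^ k := mul_pow _ _ _
        _ ≤ 2 ^ k * (1 + x ^ k) := by gcongr; linarith
  have e₀ := h₀ n
  have e₁ := h₁ n
  have e₂ := h₂ n
  have e₃ := h₃ n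
  simp only [pow_zero, one_mul, mul_one] at e₀ e₁ e₂
  rw [latticeWeight, mul_pow]
  calc _ ≤ (2 ^ k * (1 + |(n.1 : ℝ)| ^ k)) * (2 ^ k * (1 + |(n.2 : ℝ)| ^ k)) *
        ‖fourierCoeffTorus a n‖ := by
        gcongr
        · exact hpow _ (abs_nonneg _)
        · exact hpow _ (abs_nonneg _)
    _ = 2 ^ k * 2 ^ k * (‖fourierCoeffTorus a n‖ + |(n.1 : ℝ)| ^ k * ‖fourierCoeffTorus a n‖ +
        |(n.2 : ℝ)| ^ k * ‖fourierCoeffTorus a n‖ +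
        |(n.1 : ℝ)| ^ k * |(n.2 : ℝ)| ^ k * ‖fourierCoeffTorus a n‖) := by ring
    _ ≤ _ := by gcongr

lemma summable_inv_latticeWeight_sq : Summable fun n : ℤ × ℤ => (latticeWeight n ^ 2)⁻¹ := by
  have h1 : Summable fun k : ℤ => ((1 + |(k : ℝ)|) ^ 2)⁻¹ := by
    have h0 := Real.summable_one_div_int_pow (p := 2) |>.2 (by norm_num)
    -- `1 / k ^ 2` evaluates to `0` at `k = 0`; the indicator of `0` supplies the missing term.
    refine (h0.add (summable_of_ne_finset_zero (s := {0})
      (f := fun k : ℤ => if k = 0 then (1 : ℝ) else 0) ?_)).of_nonneg_of_le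
        (fun k => by positivity) (fun k => ?_)
    · intro k hk
      simp only [Finset.mem_singleton] at hk
      simp [hk]
    · rcases eq_or_ne k 0 with rfl | hk
      · simp
      · have hk0 : 0 < |(k : ℝ)| := abs_pos.2 (by exact_mod_cast hk)
        rw [if_neg hk, add_zero, one_div, ← sq_abs (k : ℝ)]
        gcongr
        linarith
  have := h1.mul_of_nonneg h1 (fun k => by positivity) (fun k => by positivity)
  refine this.congr fun n => ?_
  simp [latticeWeight, mul_pow, mul_comm]

lemma IsTorusSymbol.summable_latticeWeight_pow_mul (h : IsTorusSymbol a) (k : ℕ) :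
    Summable fun n : ℤ × ℤ => latticeWeight n ^ k * ‖fourierCoeffTorus a n‖ := by
  -- Two spare powers of the weight pay for summability.
  obtain ⟨M, hM⟩ := h.exists_latticeWeight_pow_mul_le (k + 2)
  have hw (n : ℤ × ℤ) : 0 < latticeWeight n := zero_lt_one.trans_le (one_le_latticeWeight n)
  refine (summable_inv_latticeWeight_sq.mul_left M).of_nonneg_of_le
    (fun n => mul_nonneg (pow_nonneg (hw n).le _) (norm_nonneg _)) fun n => ?_
  rw [← div_eq_mul_inv, le_div_iff₀ (pow_pos (hw n) 2)]
  refine le_trans (le_of_eq ?_) (hM n)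
  ring

end FourierDecay

end ParabolicMap

end

noncomputable section

namespace ParabolicMap

/-! ### Uniform bounds on matrix elements and the variance estimate. -/

section Variance

lemma fourierCoeffTorus_zero (a : ℝ × ℝ → ℂ) : fourierCoeffTorus a 0 = mean a := by
  simp [fourierCoeffTorus, mean]

variable {N : ℕ} [NeZero N]

lemma translation_zero (ψ : ZMod N → ℂ) : translation N 0 ψ = ψ := by
  funext q
  simp [translation]

lemma hasSum_innerN_weylOp {a : ℝ × ℝ → ℂ} (ha : IsTorusSymbol a) (φ ψ : ZMod N → ℂ) :
    HasSum (fun n => fourierCoeffTorus a n * innerN N φ (translation N n ψ))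
      (innerN N φ (weylOp N a ψ)) := by
  have hsum : Summable fun n => ‖fourierCoeffTorus a n‖ := by
    simpa using ha.summable_latticeWeight_pow_mul 0
  have hq (q : ZMod N) : HasSum (fun n => fourierCoeffTorus a n * translation N n ψ q)
      (weylOp N a ψ q) := by
    refine Summable.hasSum (Summable.of_norm_bounded (hsum.mul_right (∑ x, ‖ψ x‖)) fun n => ?_)
    rw [norm_mul, translation_apply, norm_mul, norm_mul, norm_weylPhase, norm_stdAddChar, one_mul,
      one_mul]
    exact mul_le_mul_of_nonneg_left (Finset.single_le_sum (f := fun x => ‖ψ x‖)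
      (fun x _ => norm_nonneg _) (Finset.mem_univ _)) (norm_nonneg _)
  have := (hasSum_sum (s := Finset.univ) fun q _ =>
    (hq q).mul_left (starRingEnd ℂ (φ q))).mul_left (1 / (N : ℂ))
  refine this.congr_fun fun n => ?_
  simp only [innerN, Finset.mul_sum]
  refine Finset.sum_congr rfl fun q _ => ?_
  ring

lemma sum_norm_innerN_translation_sq_le_latticeWeight {α C γ K : ℝ} (hC0 : 0 < C)
    (hC : ∀ k l : ℤ, k ≠ 0 → C / |(k : ℝ)| ^ γ ≤ |(k : ℝ) * α - (l : ℝ)|) {ν : ℤ}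
    (hν : |α - (ν : ℝ) / (N : ℝ)| ≤ K / (N : ℝ)) {k : ℕ} (hk : 1 ≤ k) (hkγ : 1 + γ ≤ k)
    {ψ : Fin N → ZMod N → ℂ} (h : IsOrthonormalEigenbasis N (quantumParabolic N ν) ψ)
    {n : ℤ × ℤ} (hn : n ≠ 0) :
    ∑ j, ‖innerN N (ψ j) (translation N n (ψ j))‖ ^ 2 ≤ max 4 (K / C) * latticeWeight n ^ k := by
  have hN : (0 : ℝ) < N := by exact_mod_cast NeZero.pos N
  have hw := one_le_latticeWeight n
  have hD : (0 : ℝ) ≤ max 4 (K / C) := le_max_of_le_left (by norm_num)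
  by_cases h2 : n.2 = 0
  · obtain ⟨m, n₂⟩ := n
    obtain rfl : n₂ = 0 := h2
    have hm : m ≠ 0 := fun h0 => hn (by simp [h0])
    by_cases hdvd : (N : ℤ) ∣ ν * m
    · refine (sum_norm_innerN_translation_sq_le h.orthonormal _).trans ?_
      have hm1 : 1 ≤ |(m : ℝ)| := by exact_mod_cast Int.one_le_abs hm
      have key := mul_le_of_dvd_of_diophantine hC hν hm hdvd
      have hNK : (N : ℝ) ≤ K / C * |(m : ℝ)| ^ (1 + γ) := by
        rw [div_mul_eq_mul_div, le_div_iff₀ hC0]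
        linarith
      refine hNK.trans ?_
      have hpow : |(m : ℝ)| ^ (1 + γ) ≤ latticeWeight (m, 0) ^ k := by
        calc |(m : ℝ)| ^ (1 + γ) ≤ |(m : ℝ)| ^ (k : ℝ) :=
              Real.rpow_le_rpow_of_exponent_le hm1 hkγ
          _ = |(m : ℝ)| ^ k := Real.rpow_natCast _ _
          _ ≤ latticeWeight (m, 0) ^ k := by
              refine pow_le_pow_left₀ (abs_nonneg _) ?_ k
              simp [latticeWeight]
      exact mul_le_mul (le_max_right _ _) hpow (by positivity) hD
    · rw [Finset.sum_eq_zero fun j _ => ?_]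
      · positivity
      · obtain ⟨μ, hμ⟩ := h.eigen j
        rw [innerN_translation_horizontal_eq_zero (by simp [h.orthonormal]) hμ m hdvd]
        simp
  · refine (sum_norm_innerN_translation_sq_le_of_ne h n h2).trans ?_
    have h3 : |(n.2 : ℝ)| ≤ latticeWeight n := by
      unfold latticeWeight
      nlinarith [abs_nonneg (n.1 : ℝ), abs_nonneg (n.2 : ℝ),
        mul_nonneg (abs_nonneg (n.1 : ℝ)) (abs_nonneg (n.2 : ℝ))]
    have h4 : latticeWeight n ≤ latticeWeight n ^ k := le_self_pow₀ hw (by omega)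
    exact mul_le_mul (le_max_left _ _) (h3.trans h4) (abs_nonneg _) hD

end Variance

/-- For a Diophantine rotation number the quantum variance is `O(1 / N)`. -/
lemma exists_quantumVariance_le {α : ℝ} (hα : Diophantine α) {ν : ℕ → ℤ}
    (hν : ∃ K : ℝ, ∀ N : ℕ, 0 < N → |α - (ν N : ℝ) / (N : ℝ)| ≤ K / (N : ℝ))
    {a : ℝ × ℝ → ℂ} (ha : IsTorusSymbol a) :
    ∃ B : ℝ, 0 ≤ B ∧ ∀ (N : ℕ) [NeZero N] (ψ : Fin N → ZMod N → ℂ),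
      IsOrthonormalEigenbasis N (quantumParabolic N (ν N)) ψ →
        quantumVariance N a ψ ≤ B / N := by
  obtain ⟨C, γ, hC0, -, hC⟩ := hα
  obtain ⟨K, hK⟩ := hν
  obtain ⟨k, hk⟩ := exists_nat_ge (max 1 (1 + γ))
  have hk1 : 1 ≤ k := by exact_mod_cast (le_max_left _ _).trans hk
  have hkγ : 1 + γ ≤ k := (le_max_right _ _).trans hk
  set D : ℝ := max 4 (K / C)
  have hD1 : 1 ≤ D := le_max_of_le_left (by norm_num)
  have hsum := (ha.summable_latticeWeight_pow_mul k).mul_left D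
  refine ⟨(∑' n, D * (latticeWeight n ^ k * ‖fourierCoeffTorus a n‖)) ^ 2, sq_nonneg _,
    fun N _ ψ h => ?_⟩
  -- Frequency `0` contributes exactly the mean and is dropped, so `‖∑ v n‖²` is `N` times the
  -- variance.
  let v : ℤ × ℤ → EuclideanSpace ℂ (Fin N) := fun n => WithLp.toLp 2 fun j =>
    if n = 0 then 0 else fourierCoeffTorus a n * innerN N (ψ j) (translation N n (ψ j))
  have hv (n : ℤ × ℤ) : ‖v n‖ ≤ D * (latticeWeight n ^ k * ‖fourierCoeffTorus a n‖) := by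
    have hwk : 1 ≤ latticeWeight n ^ k := one_le_pow₀ (one_le_latticeWeight n)
    have hDw : 1 ≤ D * latticeWeight n ^ k := one_le_mul_of_one_le_of_one_le hD1 hwk
    rcases eq_or_ne n 0 with hn | hn
    · have : v n = 0 := by ext j; simp [v, hn]
      rw [this, norm_zero]
      positivity
    · refine le_of_pow_le_pow_left₀ two_ne_zero (by positivity) ?_
      have hb := sum_norm_innerN_translation_sq_le_latticeWeight hC0 hC (hK N (NeZero.pos N))
        hk1 hkγ h hn
      calc ‖v n‖ ^ 2 = ‖fourierCoeffTorus a n‖ ^ 2 *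
            ∑ j, ‖innerN N (ψ j) (translation N n (ψ j))‖ ^ 2 := by
            simp [EuclideanSpace.norm_sq_eq, v, hn, mul_pow, Finset.mul_sum]
        _ ≤ ‖fourierCoeffTorus a n‖ ^ 2 * (D * latticeWeight n ^ k) ^ 2 := by
            gcongr
            -- Squaring a factor that is at least 1 is a harmless loss and avoids a square root.
            exact hb.trans (le_self_pow₀ hDw two_ne_zero)
        _ = _ := by ring
  have hvsum : Summable v := Summable.of_norm_bounded hsum hv
  have hcoord (j : Fin N) : (∑' n, v n) j = innerN N (ψ j) (weylOp N a (ψ j)) - mean a := by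
    have h1 : innerN N (ψ j) (ψ j) = 1 := by simp [h.orthonormal]
    have hs := hasSum_ite_sub_hasSum (hasSum_innerN_weylOp ha (ψ j) (ψ j)) 0
    rw [translation_zero, h1, mul_one, fourierCoeffTorus_zero] at hs
    exact ((EuclideanSpace.proj (𝕜 := ℂ) j).hasSum hvsum.hasSum).unique hs
  have hnorm : ‖∑' n, v n‖ ≤ ∑' n, D * (latticeWeight n ^ k * ‖fourierCoeffTorus a n‖) :=
    tsum_of_norm_bounded hsum.hasSum hv
  have hvar : quantumVariance N a ψ = ‖∑' n, v n‖ ^ 2 / N := by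
    rw [quantumVariance, EuclideanSpace.norm_sq_eq]
    simp only [hcoord]
    ring
  rw [hvar]
  gcongr

end ParabolicMap

end

theorem theorem5 (α : ℝ) (hα : ParabolicMap.Diophantine α)
    (ν : ℕ → ℤ) (hν : ∃ K : ℝ, ∀ N : ℕ, 0 < N → |α - (ν N : ℝ) / (N : ℝ)| ≤ K / (N : ℝ)) :
    (∀ a : ℝ × ℝ → ℂ, ParabolicMap.IsTorusSymbol a →
      ∃ C : ℝ, ∀ (N : ℕ) [NeZero N] (ψ : Fin N → ZMod N → ℂ),
        ParabolicMap.IsOrthonormalEigenbasis N (ParabolicMap.quantumParabolic N (ν N)) ψ →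
          ParabolicMap.quantumVariance N a ψ ≤ C * (1 / (N : ℝ) ^ (1 / 2 : ℝ))) ∧
    (∀ a : ℝ × ℝ → ℂ, ParabolicMap.IsTorusSymbol a → ParabolicMap.DependsOnlyOnP a →
      ∀ ε : ℝ, 0 < ε → ∃ C : ℝ, ∀ (N : ℕ) [NeZero N] (ψ : Fin N → ZMod N → ℂ),
        ParabolicMap.IsOrthonormalEigenbasis N (ParabolicMap.quantumParabolic N (ν N)) ψ →
          ParabolicMap.quantumVariance N a ψ ≤ C * (1 / (N : ℝ) ^ (1 - ε))) := by
  -- As `N ≥ 1`, the rate `1/N` implies every rate `N^(-s)` with `s ≤ 1`, in particular `s = 1/2`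
  -- and `s = 1 - ε`.
  have weaken (N : ℕ) [NeZero N] (s : ℝ) (hs : s ≤ 1) {B : ℝ} (hB : 0 ≤ B) :
      B / N ≤ B * (1 / (N : ℝ) ^ s) := by
    have hN : (1 : ℝ) ≤ N := by exact_mod_cast NeZero.one_le
    rw [mul_one_div]
    refine div_le_div_of_nonneg_left hB (Real.rpow_pos_of_pos (by linarith) _) ?_
    simpa using Real.rpow_le_rpow_of_exponent_le hN hs
  refine ⟨fun a ha => ?_, fun a ha _ ε hε => ?_⟩
  · obtain ⟨B, hB, h⟩ := ParabolicMap.exists_quantumVariance_le hα hν ha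
    exact ⟨B, fun N _ ψ hψ => (h N ψ hψ).trans (weaken N _ (by norm_num) hB)⟩
  · obtain ⟨B, hB, h⟩ := ParabolicMap.exists_quantumVariance_le hα hν ha
    exact ⟨B, fun N _ ψ hψ => (h N ψ hψ).trans (weaken N _ (by linarith) hB)⟩
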